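/- Let $r,p\ge 0$ be integers and let $[m]=[m_1,\dots,m_p]$, $m_1\ge\dots\ge m_p\ge 0$, $\sum_i m_i=r$, be a frame (Young diagram with $r$ boxes, whose rows may have length zero). Let $\rho^{[m]}$ be the representation of the symmetric group $S_r$ labelled by $[m]$, that is, the action by left multiplication on the left ideal of $\mathbb C[S_r]$ generated by the Young symmetrizer $\big(\sum_{\sigma\in R_T}\sigma\big)\big(\sum_{\sigma\in C_T}\operatorname{sgn}(\sigma)\,\sigma\big)$, where $R_T$ and $C_T$ are the groups of permutations preserving the rows, respectively the columns, of some tableau $T$ on $[m]$ (any numbering of the boxes by $1,\dots,r$). Let $n_{[m]}$ be its dimension and $\chi^{[m]}_\alpha$ the value of its character on the conjugacy class $\alpha$ of $S_r$; let $h_\alpha$ be the number of elements of $\alpha$, $k_\alpha=\sum_{\sigma\in\alpha}\sigma\in\mathbb C[S_r]$, and let $|\alpha|$ be the number of cycles (fixed points included) of an element of $\alpha$. Put \[ t_{[m]}(c)=\frac{1}{n_{[m]}}\sum_{\alpha}h_\alpha\,\chi^{[m]}_\alpha\,c^{|\alpha|}\in\mathbb C[c],\qquad [y]_k=y(y+1)\cdots(y+k-1),\quad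 [y]_0=1 . \] Then, for every choice of the tableau $T$, the representation $\rho^{[m]}$ is irreducible, and \[ t_{[m]}(c)=[c]_{m_1}[c-1]_{m_2}\cdots[c-p+1]_{m_p}=\prod_{(i,j)}(c+j-i), \] the last product being over all boxes $(i,j)$ ($i$-th row, $j$-th column) of the frame. Moreover, for every $c\in\mathbb C$ the element $\sum_{\alpha}c^{|\alpha|}k_\alpha=\sum_{\sigma\in S_r}c^{\#\text{cycles}(\sigma)}\,\sigma$ lies in the centre of $\mathbb C[S_r]$ and acts in the representation $\rho^{[m]}$ as multiplication by the scalar $t_{[m]}(c)$. -/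

import Mathlib

noncomputable section

namespace FrameRep

open Polynomial

/-- The symmetric group `S_r`. -/
abbrev Sym (r : ℕ) : Type := Equiv.Perm (Fin r)

/-- The complex group algebra `ℂ[S_r]`. -/
abbrev GrpAlg (r : ℕ) : Type := MonoidAlgebra ℂ (Sym r)

/-! ### Conjugacy classes of `S_r` -/

/-- The number of cycles of a permutation, where fixed points count as cycles of length one. -/
def cycleCount {r : ℕ} (σ : Sym r) : ℕ := σ.partition.parts.card

/-- `|α|`: the number of cycles of the elements of the conjugacy class `α`. -/
def classCycleCount {r : ℕ} (α : ConjClasses (Sym r)) : ℕ :=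
  Quotient.liftOn α cycleCount fun _ _ h => by
    unfold cycleCount
    rw [Equiv.Perm.partition_eq_of_isConj.mp h]

/-- `h_α`: the number of elements of the conjugacy class `α`. -/
def classSize {r : ℕ} (α : ConjClasses (Sym r)) : ℕ := α.carrier.ncard

/-- `k_α`: the sum of the elements of the conjugacy class `α` in the group algebra. -/
def classSum {r : ℕ} (α : ConjClasses (Sym r)) : GrpAlg r :=
  ∑ σ ∈ α.carrier.toFinset, MonoidAlgebra.single σ 1

/-- The value on the conjugacy class `α` of the character of a representation of `S_r`. -/
def classChar {r : ℕ} {V : Type*} [AddCommGroup V] [Module ℂ V]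
    (ρ : Representation ℂ (Sym r) V) (α : ConjClasses (Sym r)) : ℂ :=
  Quotient.liftOn α (fun σ => LinearMap.trace ℂ V (ρ σ)) fun σ τ h => by
    obtain ⟨g, rfl⟩ := isConj_iff.mp h
    rw [map_mul, LinearMap.trace_mul_comm, ← map_mul]
    simp

/-- The element `∑_σ c ^ {number of cycles of σ} σ = ∑_α c ^ |α| k_α` of the group algebra. -/
def cycleElement (r : ℕ) (c : ℂ) : GrpAlg r :=
  ∑ α : ConjClasses (Sym r), c ^ classCycleCount α • classSum α

/-! ### The representation of `S_r` labelled by a frame -/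

/-- A tableau on the frame `μ`: a numbering of the boxes of `μ` by the elements of `Fin r`
(so that `μ` has `r` boxes). Boxes are pairs (row, column), both counted from zero. -/
abbrev Tableau (μ : YoungDiagram) (r : ℕ) : Type := {x // x ∈ μ.cells} ≃ Fin r

variable {μ : YoungDiagram} {r : ℕ}

/-- The permutations that preserve every row of the tableau `T`. -/
def rowGroup (T : Tableau μ r) : Set (Sym r) :=
  {σ | ∀ a, (T.symm (σ a)).1.1 = (T.symm a).1.1}

/-- The permutations that preserve every column of the tableau `T`. -/
def colGroup (T : Tableau μ r) : Set (Sym r) :=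
  {σ | ∀ a, (T.symm (σ a)).1.2 = (T.symm a).1.2}

open Classical in
/-- The row symmetrizer of `T`. -/
def rowSymmetrizer (T : Tableau μ r) : GrpAlg r :=
  ∑ σ ∈ (rowGroup T).toFinset, MonoidAlgebra.single σ 1

open Classical in
/-- The column antisymmetrizer of `T`. -/
def colAntisymmetrizer (T : Tableau μ r) : GrpAlg r :=
  ∑ σ ∈ (colGroup T).toFinset, MonoidAlgebra.single σ ((Equiv.Perm.sign σ : ℤ) : ℂ)

/-- The Young symmetrizer of `T`. -/
def youngSymmetrizer (T : Tableau μ r) : GrpAlg r := rowSymmetrizer T * colAntisymmetrizer T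

/-- The left ideal of `ℂ[S_r]` generated by the Young symmetrizer of `T`. -/
abbrev spechtModule (T : Tableau μ r) : Submodule (GrpAlg r) (GrpAlg r) :=
  Submodule.span (GrpAlg r) {youngSymmetrizer T}

/-- The representation of `S_r` labelled by the frame `μ`: the group acts by left multiplication
on the left ideal generated by the Young symmetrizer of a tableau on `μ`. -/
def frameRep (T : Tableau μ r) : Representation ℂ (Sym r) (spechtModule T) :=
  Representation.ofModule' (spechtModule T)

/-- The polynomial `t(c) = (1 / n) ∑_α h_α χ_α c ^ |α|` of a representation of `S_r` with
character `χ` and dimension `n`. -/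
def tPoly {V : Type*} [AddCommGroup V] [Module ℂ V]
    (ρ : Representation ℂ (Sym r) V) : ℂ[X] :=
  C ((Module.finrank ℂ V : ℂ)⁻¹) *
    ∑ α : ConjClasses (Sym r), C ((classSize α : ℂ) * classChar ρ α) * X ^ classCycleCount α

end FrameRep

end

noncomputable section

namespace FrameRep

open Polynomial Equiv

/-! Let `e` be the Young symmetrizer and `z` the cycle element. A permutation `g` either factors as
a row permutation times a column permutation, or carries two boxes of one column into one row; then
a transposition argument kills its contribution between the two symmetrizers. Hence `e x e` is
always a multiple of `e` (`exists_youngSymmetrizer_mul_mul`). With Maschke's theorem this gives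
irreducibility, and shows that a central `z` satisfies `z e = k e`.

Since `e` has coefficient 1 at the identity, `k` is the coefficient of `z e` there, namely the sum
of `sgn q * c ^ cycles(pq)` over row permutations `p` and column permutations `q`. Taking traces
identifies `k` with `t(c)`.

This sum is computed by removing an outer corner `x` (`cycleSum_insert`). Coset representatives for
the enlarged row and column groups are transpositions involving `x`, each of which merges the fixed
point `x` into another cycle and so costs one factor `c`. The row terms contribute the column index
of `x`, the column terms minus its row index, and the mixed terms cancel. Each box thus yields its
factor `c + j - i`. -/

/-! ### Cycle counts and transpositions. -/

theorem cycleCount_eq {r : ℕ} (σ : Sym r) :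
    cycleCount σ = σ.cycleType.card + (r - σ.support.card) := by
  simp [cycleCount, Equiv.Perm.parts_partition]

theorem cycleCount_inv {r : ℕ} (σ : Sym r) : cycleCount σ⁻¹ = cycleCount σ := by
  simp [cycleCount_eq, Equiv.Perm.cycleType_inv]

theorem cycleCount_conj {r : ℕ} (σ τ : Sym r) : cycleCount (τ * σ * τ⁻¹) = cycleCount σ := by
  simp only [cycleCount_eq, Equiv.Perm.cycleType_conj, Equiv.Perm.card_support_conj]

theorem cycleCount_mul_comm {r : ℕ} (σ τ : Sym r) : cycleCount (σ * τ) = cycleCount (τ * σ) := by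
  rw [← cycleCount_conj (σ * τ) τ]; simp [mul_assoc]

/-- The product sends `y` to `x` and `x` to `c y`, so `x` is spliced into the cycle right after `y`;
elsewhere it agrees with `c`. -/
theorem isCycle_mul_swap {α : Type*} [Finite α] [DecidableEq α] {c : Perm α} (hc : c.IsCycle) {x y : α}
    (hx : c x = x) (hy : c y ≠ y) : (c * swap y x).IsCycle := by
  have hxy : x ≠ y := fun h => hy (h ▸ hx)
  have hfy : (c * swap y x) y = x := by simp [hx]
  have hfx : (c * swap y x) x = c y := by simp
  have hsx : (c * swap y x).SameCycle y x := ⟨1, by rw [zpow_one, hfy]⟩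
  have key : ∀ n : ℕ, (c * swap y x).SameCycle y ((c ^ n) y) := by
    intro n
    induction n with
    | zero => exact Perm.SameCycle.refl _ _
    | succ n ih =>
      rw [pow_succ', Perm.mul_apply]
      by_cases h : (c ^ n) y = y
      · rw [h, ← hfx, Perm.sameCycle_apply_right]
        exact hsx
      · have hne : (c ^ n) y ≠ x := by
          intro h'
          have h2 : c ((c ^ n) y) = (c ^ n) y := by rw [h', hx]
          rw [← Perm.mul_apply, ← pow_succ', pow_succ, Perm.mul_apply] at h2
          exact hy ((c ^ n).injective h2)
        have : (c * swap y x) ((c ^ n) y) = c ((c ^ n) y) := by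
          rw [Perm.mul_apply, swap_apply_of_ne_of_ne h hne]
        rw [← this, Perm.sameCycle_apply_right]
        exact ih
  refine ⟨y, by rw [hfy]; exact hxy, fun b hb => ?_⟩
  by_cases hbx : b = x
  · rw [hbx]
    exact hsx
  by_cases hcb : c b = b
  · by_cases hby : b = y
    · rw [hby]
    · rw [Perm.mul_apply, swap_apply_of_ne_of_ne hby hbx] at hb
      exact absurd hcb hb
  · obtain ⟨n, hn⟩ := hc.exists_pow_eq hy hcb
    rw [← hn]
    exact key n

theorem support_mul_swap {α : Type*} [Fintype α] [DecidableEq α] {c : Perm α} {x y : α}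
    (hx : c x = x) (hy : c y ≠ y) : (c * swap y x).support = insert x c.support := by
  have hxy : x ≠ y := fun h => hy (h ▸ hx)
  ext b
  rw [Finset.mem_insert, Perm.mem_support, Perm.mem_support, Perm.mul_apply]
  by_cases hbx : b = x
  · subst hbx
    rw [swap_apply_right]
    simp only [true_or, iff_true]
    intro h
    rw [← hx] at h
    exact hxy (c.injective h).symm
  · by_cases hby : b = y
    · subst hby
      simp [hx, hy, hxy]
    · rw [swap_apply_of_ne_of_ne hby hbx]
      simp [hbx]

/-- Multiplying by a transposition that attaches a fixed point `x` to the cycle of `y` lowers the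
number of cycles by one. -/
theorem cycleCount_mul_swap {r : ℕ} {σ : Sym r} {x y : Fin r} (hx : σ x = x) (hxy : y ≠ x) :
    cycleCount (σ * swap y x) + 1 = cycleCount σ := by
  by_cases hy : σ y = y
  · have hd : Perm.Disjoint σ (swap y x) := by
      intro a
      by_cases h1 : a = y
      · left; rw [h1, hy]
      by_cases h2 : a = x
      · left; rw [h2, hx]
      · right; exact swap_apply_of_ne_of_ne h1 h2
    have hs : (swap y x).cycleType = {2} := Perm.isSwap_iff_cycleType.mp ⟨y, x, hxy, rfl⟩
    have hle := Finset.card_le_univ (σ * swap y x).support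
    rw [cycleCount_eq, cycleCount_eq, hd.cycleType_mul, hs]
    rw [hd.card_support_mul, Perm.card_support_swap hxy, Fintype.card_fin] at *
    simp only [Multiset.card_add, Multiset.card_singleton]
    omega
  -- Write `σ = d * c` with `c` the cycle through `y`: splicing in `x` changes only `c`, enlarging
  -- its support by one point.
  · have hc : (σ.cycleOf y).IsCycle := Perm.isCycle_cycleOf σ hy
    have hcy : σ.cycleOf y y ≠ y := by rwa [Perm.cycleOf_apply_self]
    have hcx : σ.cycleOf y x = x := by
      rw [Perm.cycleOf_apply]
      split_ifs <;> simp [hx]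
    have hd : Perm.Disjoint (σ * (σ.cycleOf y)⁻¹) (σ.cycleOf y) :=
      Perm.disjoint_mul_inv_of_mem_cycleFactorsFinset
        (Perm.cycleOf_mem_cycleFactorsFinset_iff.mpr (Perm.mem_support.mpr hy))
    obtain ⟨d, hdef⟩ : ∃ d, d = σ * (σ.cycleOf y)⁻¹ := ⟨_, rfl⟩
    rw [← hdef] at hd
    have hσ : σ = d * σ.cycleOf y := by rw [hdef]; simp
    have hdx : d x = x := by
      rw [hdef, Perm.mul_apply, Perm.inv_eq_iff_eq.mpr hcx.symm, hx]
    generalize σ.cycleOf y = c at *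
    subst hσ
    clear hdef
    have hd' : Perm.Disjoint d (c * swap y x) := by
      rw [Perm.disjoint_iff_disjoint_support, support_mul_swap hcx hcy,
        Finset.disjoint_insert_right]
      exact ⟨by simpa using hdx, Perm.disjoint_iff_disjoint_support.mp hd⟩
    have hle := Finset.card_le_univ (d * (c * swap y x)).support
    have hx' : x ∉ c.support := by simpa using hcx
    rw [mul_assoc, cycleCount_eq, cycleCount_eq, hd.cycleType_mul, hd'.cycleType_mul,
      hc.cycleType, (isCycle_mul_swap hc hcx hcy).cycleType]
    rw [hd.card_support_mul, hd'.card_support_mul, support_mul_swap hcx hcy,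
      Finset.card_insert_of_notMem hx', Fintype.card_fin] at *
    simp only [Multiset.card_add, Multiset.card_singleton]
    omega

/-! ### Row and column stabilizers and their cosets. -/

/-- The permutations that preserve the function `f` and fix every point outside `s`. -/
def stab {r : ℕ} (f : Fin r → ℕ) (s : Finset (Fin r)) : Finset (Sym r) :=
  Finset.univ.filter fun σ => ∀ a, f (σ a) = f a ∧ (a ∉ s → σ a = a)

section Stab

variable {r : ℕ} {f : Fin r → ℕ} {s : Finset (Fin r)}

theorem mem_stab {σ : Sym r} : σ ∈ stab f s ↔ ∀ a, f (σ a) = f a ∧ (a ∉ s → σ a = a) := by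
  simp [stab]

theorem mul_mem_stab {σ τ : Sym r} (hσ : σ ∈ stab f s) (hτ : τ ∈ stab f s) :
    σ * τ ∈ stab f s := by
  rw [mem_stab] at *
  intro a
  refine ⟨by rw [Perm.mul_apply, (hσ _).1, (hτ _).1], fun ha => ?_⟩
  rw [Perm.mul_apply, (hτ a).2 ha, (hσ a).2 ha]

theorem inv_mem_stab {σ : Sym r} (hσ : σ ∈ stab f s) : σ⁻¹ ∈ stab f s := by
  rw [mem_stab] at *
  intro a
  refine ⟨?_, fun ha => ?_⟩
  · conv_rhs => rw [← (show σ (σ⁻¹ a) = a by simp)]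
    rw [(hσ _).1]
  · rw [Perm.inv_eq_iff_eq, (hσ a).2 ha]

theorem inv_mem_stab_iff {σ : Sym r} : σ⁻¹ ∈ stab f s ↔ σ ∈ stab f s :=
  ⟨fun h => by simpa using inv_mem_stab h, inv_mem_stab⟩

theorem swap_mem_stab {x y : Fin r} (hx : x ∈ s) (hy : y ∈ s) (h : f x = f y) :
    swap x y ∈ stab f s := by
  rw [mem_stab]
  intro a
  by_cases h1 : a = x
  · subst h1
    simp [h, hx]
  by_cases h2 : a = y
  · subst h2
    simp [h, hy]
  rw [swap_apply_of_ne_of_ne h1 h2]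
  simp

theorem mul_mem_stab_iff_left {σ τ : Sym r} (hσ : σ ∈ stab f s) :
    σ * τ ∈ stab f s ↔ τ ∈ stab f s :=
  ⟨fun h => by simpa using mul_mem_stab (inv_mem_stab hσ) h, mul_mem_stab hσ⟩

theorem mul_mem_stab_iff_right {σ τ : Sym r} (hτ : τ ∈ stab f s) :
    σ * τ ∈ stab f s ↔ σ ∈ stab f s :=
  ⟨fun h => by simpa using mul_mem_stab h (inv_mem_stab hτ), fun h => mul_mem_stab h hτ⟩

theorem stab_mono {t : Finset (Fin r)} (h : s ⊆ t) : stab f s ⊆ stab f t := by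
  intro σ hσ
  rw [mem_stab] at *
  exact fun a => ⟨(hσ a).1, fun ha => (hσ a).2 fun h' => ha (h h')⟩

theorem stab_empty : stab f ∅ = {1} := by
  ext σ
  rw [mem_stab, Finset.mem_singleton]
  refine ⟨fun h => Equiv.ext fun a => (h a).2 (by simp), ?_⟩
  rintro rfl
  simp

/-- The coset decomposition of the stabilizer with respect to a new point, on the right. -/
theorem sum_stab_insert {M : Type*} [AddCommMonoid M] {x : Fin r} (hx : x ∉ s) (φ : Sym r → M) :
    ∑ σ ∈ stab f (insert x s), φ σ =
      ∑ p ∈ stab f s, (φ p + ∑ y ∈ s with f y = f x, φ (p * swap y x)) := by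
  have hx' : x ∉ s.filter (fun y => f y = f x) := by simp [hx]
  have : ∀ p ∈ stab f s, φ p + ∑ y ∈ s with f y = f x, φ (p * swap y x) =
      ∑ y ∈ insert x (s.filter fun y => f y = f x), φ (p * swap y x) := by
    intro p _
    rw [Finset.sum_insert hx', swap_self, ← Perm.one_def, mul_one]
  rw [Finset.sum_congr rfl this, ← Finset.sum_product']
  have hfix : ∀ p ∈ stab f s, p x = x := fun p hp => (mem_stab.mp hp x).2 hx
  -- The coset of `σ` is determined by `y = σ⁻¹ x`; the case `y = x` is the bare term `φ p`.
  refine Finset.sum_bij' (fun σ _ => (σ * swap (σ⁻¹ x) x, σ⁻¹ x)) (fun py _ => py.1 * swap py.2 x)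
    ?_ ?_ ?_ ?_ ?_
  · intro σ hσ
    have hinv := mem_stab.mp (inv_mem_stab hσ) x
    have hmem : σ⁻¹ x ∈ insert x s := by
      by_contra h
      have h1 := (mem_stab.mp hσ _).2 h
      rw [show σ (σ⁻¹ x) = x by simp] at h1
      exact h (by simp [← h1])
    have hprod : σ * swap (σ⁻¹ x) x ∈ stab f (insert x s) :=
      mul_mem_stab hσ (swap_mem_stab hmem (by simp) hinv.1)
    rw [Finset.mem_product]
    constructor
    · rw [mem_stab] at hprod ⊢
      refine fun a => ⟨(hprod a).1, fun ha => ?_⟩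
      by_cases hax : a = x
      · subst hax
        simp
      · exact (hprod a).2 (by simp [hax, ha])
    · rw [Finset.mem_insert] at hmem ⊢
      refine hmem.imp id fun h => Finset.mem_filter.mpr ⟨h, hinv.1⟩
  · rintro ⟨p, y⟩ h
    rw [Finset.mem_product] at h
    refine mul_mem_stab (stab_mono (Finset.subset_insert _ _) h.1) ?_
    have h2 := h.2
    simp only [Finset.mem_insert, Finset.mem_filter] at h2
    rcases h2 with h2 | h2
    · simp only [h2]
      exact swap_mem_stab (by simp) (by simp) rfl
    · exact swap_mem_stab (by simp [h2.1]) (by simp) h2.2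
  · intro σ _
    simp [mul_assoc]
  · rintro ⟨p, y⟩ h
    rw [Finset.mem_product] at h
    have hp := hfix p h.1
    have hp' : p⁻¹ x = x := Perm.inv_eq_iff_eq.mpr hp.symm
    have : (p * swap y x)⁻¹ x = y := by rw [mul_inv_rev, Perm.mul_apply, hp']; simp
    simp only [this, mul_assoc, swap_mul_self, mul_one]
  · intro σ _
    simp [mul_assoc]

theorem sum_stab_inv {M : Type*} [AddCommMonoid M] (φ : Sym r → M) :
    ∑ σ ∈ stab f s, φ σ⁻¹ = ∑ σ ∈ stab f s, φ σ :=
  Finset.sum_equiv (Equiv.inv _) (fun σ => by simp [inv_mem_stab_iff]) (fun σ _ => by simp)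

/-- The coset decomposition of the stabilizer with respect to a new point, on the left. -/
theorem sum_stab_insert' {M : Type*} [AddCommMonoid M] {x : Fin r} (hx : x ∉ s) (φ : Sym r → M) :
    ∑ σ ∈ stab f (insert x s), φ σ =
      ∑ q ∈ stab f s, (φ q + ∑ y ∈ s with f y = f x, φ (swap y x * q)) := by
  rw [← sum_stab_inv, sum_stab_insert hx, ← sum_stab_inv]
  simp

/-- Replacing `p` by `p * swap u v` permutes the outer sum; moved through `g`, the transposition
becomes `swap u' v'`, which is absorbed into `q` at the price of a sign. The sum therefore equals
its own negative. -/
theorem sum_sum_sign_smul_eq_zero {M : Type*} [AddCommGroup M] [Module ℂ M] {f' : Fin r → ℕ}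
    (φ : Sym r → M) {g : Sym r} {u v u' v' : Fin r} (ht : swap u v ∈ stab f s)
    (ht' : swap u' v' ∈ stab f' s) (hne : u' ≠ v') (hg : swap u v * g = g * swap u' v') :
    ∑ p ∈ stab f s, ∑ q ∈ stab f' s, ((Perm.sign q : ℤ) : ℂ) • φ (p * g * q) = 0 := by
  refine (smul_eq_zero.mp ?_).resolve_left (two_ne_zero (α := ℂ))
  rw [two_smul, add_eq_zero_iff_eq_neg]
  calc _ = ∑ p ∈ stab f s, ∑ q ∈ stab f' s, ((Perm.sign q : ℤ) : ℂ) •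
          φ (p * swap u v * g * q) :=
        (Finset.sum_equiv (Equiv.mulRight (swap u v))
          (fun p => by simp [mul_mem_stab_iff_right ht]) (fun p _ => by simp)).symm
    _ = ∑ p ∈ stab f s, ∑ q ∈ stab f' s, ((Perm.sign q : ℤ) : ℂ) •
          φ (p * g * (swap u' v' * q)) := by
        simp only [mul_assoc _ (swap u v) g, hg, mul_assoc]
    _ = ∑ p ∈ stab f s, ∑ q ∈ stab f' s, -(((Perm.sign q : ℤ) : ℂ) • φ (p * g * q)) := by
        refine Finset.sum_congr rfl fun p _ => Finset.sum_equiv (Equiv.mulLeft (swap u' v'))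
          (fun q => by simp [mul_mem_stab_iff_left ht']) (fun q _ => ?_)
        simp [Perm.sign_mul, Perm.sign_swap hne]
    _ = _ := by simp only [Finset.sum_neg_distrib]

end Stab

/-! ### The sum of signed powers of cycle counts -/

section CycleSum

variable {r : ℕ} (row col : Fin r → ℕ)

/-- The sum of `sgn q * c ^ {number of cycles of pq}` over the row permutations `p` and the column
permutations `q` of the boxes in `s`. -/
def cycleSum (c : ℂ) (s : Finset (Fin r)) : ℂ :=
  ∑ p ∈ stab row s, ∑ q ∈ stab col s, ((Perm.sign q : ℤ) : ℂ) • c ^ cycleCount (p * q)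

variable {row col}

/-- Leaves only one transposition involving `x`, so that a mixed term loses a single cycle relative
to a permutation fixing `x`. -/
theorem swap_mul_swap_eq {x y z : Fin r} (hxy : y ≠ x) (hxz : z ≠ x) (hyz : y ≠ z) :
    swap y x * swap z x = swap y z * swap y x := by
  ext a
  by_cases h1 : a = x
  · subst h1; simp [swap_apply_of_ne_of_ne hyz.symm hxz]
  by_cases h2 : a = y
  · subst h2; simp [swap_apply_of_ne_of_ne hyz h1, swap_apply_of_ne_of_ne hxy.symm hxz.symm]
  by_cases h3 : a = z
  · subst h3; simp [swap_apply_of_ne_of_ne h2 h1]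
  · simp [swap_apply_of_ne_of_ne, h1, h2, h3]

theorem swap_mul_swap_eq_of_ne {w y z : Fin r} (hy : w ≠ y) (hz : w ≠ z) :
    swap y z * swap w y = swap w z * swap y z := by
  have := Equiv.mul_swap_eq_swap_mul (swap y z) w y
  rwa [swap_apply_of_ne_of_ne hy hz, swap_apply_left] at this

/-- Expanding both groups over cosets at `x` gives four kinds of terms. The pure ones reproduce
`cycleSum` on `s`; the mixed ones vanish in total thanks to the box `w` of `hcorner`. The factor `c`
on the left avoids dividing where a cycle is lost. -/
theorem cycleSum_insert (c : ℂ) {s : Finset (Fin r)} {x : Fin r} (hx : x ∉ s)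
    (hinj : ∀ u v, row u = row v → col u = col v → u = v)
    (hcorner : ∀ y ∈ s, ∀ z ∈ s, row y = row x → col z = col x →
      ∃ w ∈ s, row w = row z ∧ col w = col y) :
    c * cycleSum row col c (insert x s) =
      (c + (s.filter fun y => row y = row x).card - (s.filter fun y => col y = col x).card) *
        cycleSum row col c s := by
  have hp : ∀ {f : Fin r → ℕ}, ∀ p ∈ stab f s, p x = x := fun p hp => (mem_stab.mp hp x).2 hx
  have hne : ∀ y ∈ s, y ≠ x := fun y hy h => hx (h ▸ hy)
  have h1 : ∀ p ∈ stab row s, ∀ q ∈ stab col s, ∀ y ∈ s,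
      c * c ^ cycleCount (p * swap y x * q) = c ^ cycleCount (p * q) := by
    intro p hp' q hq' y hy
    -- Cyclic rotation puts the transposition last, after a product `q * p` that fixes `x`.
    rw [cycleCount_mul_comm, ← mul_assoc, ← pow_succ', cycleCount_mul_swap _ (hne y hy),
      cycleCount_mul_comm]
    rw [Perm.mul_apply, hp p hp', hp q hq']
  have h2 : ∀ p ∈ stab row s, ∀ q ∈ stab col s, ∀ y ∈ s, row y = row x → ∀ z ∈ s, col z = col x →
      c * c ^ cycleCount (p * swap y x * (swap z x * q)) =
        c ^ cycleCount (p * swap y z * q) := by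
    intro p hp' q hq' y hy hyx z hz hzx
    have hyz : y ≠ z := by
      rintro rfl
      exact hne y hy (hinj _ _ hyx hzx)
    have e : p * swap y x * (swap z x * q) = p * swap y z * swap y x * q := by
      rw [mul_assoc p, ← mul_assoc (swap y x), swap_mul_swap_eq (hne y hy) (hne z hz) hyz]
      simp only [mul_assoc]
    rw [e, cycleCount_mul_comm, ← mul_assoc, ← pow_succ', cycleCount_mul_swap _ (hne y hy),
      cycleCount_mul_comm]
    rw [Perm.mul_apply, Perm.mul_apply, swap_apply_of_ne_of_ne (hne y hy).symm (hne z hz).symm,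
      hp p hp', hp q hq']
  have h3 : ∀ y ∈ s, row y = row x → ∀ z ∈ s, col z = col x →
      ∑ p ∈ stab row s, ∑ q ∈ stab col s,
        ((Perm.sign q : ℤ) : ℂ) • c ^ cycleCount (p * swap y z * q) = 0 := by
    intro y hy hyx z hz hzx
    obtain ⟨w, hw, hwz, hwy⟩ := hcorner y hy z hz hyx hzx
    have hwy' : w ≠ y := by
      rintro rfl
      exact hne z hz (hinj _ _ (hwz.symm.trans hyx) hzx)
    have hwz' : w ≠ z := by
      rintro rfl
      exact hne y hy (hinj _ _ hyx (hwy.symm.trans hzx))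
    -- Conjugation by `swap y z` exchanges the row transposition of `w, z` with the column
    -- transposition of `w, y`.
    refine sum_sum_sign_smul_eq_zero (fun σ => c ^ cycleCount σ) (swap_mem_stab hw hz hwz)
      (swap_mem_stab hw hy hwy) hwy' ?_
    exact (swap_mul_swap_eq_of_ne hwy' hwz').symm
  have expand : cycleSum row col c (insert x s) = ∑ p ∈ stab row s, ∑ q ∈ stab col s,
      ((Perm.sign q : ℤ) : ℂ) * (c ^ cycleCount (p * q)
        + ∑ y ∈ s with row y = row x, c ^ cycleCount (p * swap y x * q)
        - ∑ z ∈ s with col z = col x, c ^ cycleCount (p * swap z x * q)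
        - ∑ y ∈ s with row y = row x, ∑ z ∈ s with col z = col x,
            c ^ cycleCount (p * swap y x * (swap z x * q))) := by
    have hq : ∀ F : Sym r → ℂ,
        ∑ q ∈ stab col (insert x s), ((Perm.sign q : ℤ) : ℂ) • F q =
          ∑ q ∈ stab col s, ((Perm.sign q : ℤ) : ℂ) *
            (F q - ∑ z ∈ s with col z = col x, F (swap z x * q)) := by
      intro F
      rw [sum_stab_insert' hx]
      refine Finset.sum_congr rfl fun q _ => ?_
      rw [mul_sub, sub_eq_add_neg, Finset.mul_sum, ← Finset.sum_neg_distrib, smul_eq_mul]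
      congr 1
      refine Finset.sum_congr rfl fun z hz => ?_
      simp [Perm.sign_swap (hne z (Finset.mem_filter.mp hz).1)]
    rw [cycleSum, sum_stab_insert hx]
    refine Finset.sum_congr rfl fun p _ => ?_
    simp only [hq]
    rw [Finset.sum_comm, ← Finset.sum_add_distrib]
    refine Finset.sum_congr rfl fun q _ => ?_
    rw [← Finset.mul_sum, ← mul_add, Finset.sum_sub_distrib]
    simp only [← mul_assoc p]
    ring
  have hterm : ∀ p ∈ stab row s, ∀ q ∈ stab col s,
      c * (((Perm.sign q : ℤ) : ℂ) * (c ^ cycleCount (p * q)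
        + ∑ y ∈ s with row y = row x, c ^ cycleCount (p * swap y x * q)
        - ∑ z ∈ s with col z = col x, c ^ cycleCount (p * swap z x * q)
        - ∑ y ∈ s with row y = row x, ∑ z ∈ s with col z = col x,
            c ^ cycleCount (p * swap y x * (swap z x * q)))) =
      (c + (s.filter fun y => row y = row x).card - (s.filter fun y => col y = col x).card) *
        (((Perm.sign q : ℤ) : ℂ) * c ^ cycleCount (p * q)) -
      ∑ y ∈ s with row y = row x, ∑ z ∈ s with col z = col x,
        ((Perm.sign q : ℤ) : ℂ) • c ^ cycleCount (p * swap y z * q) := by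
    intro p hp' q hq'
    have e1 : c * ∑ y ∈ s with row y = row x, c ^ cycleCount (p * swap y x * q) =
        (s.filter fun y => row y = row x).card * c ^ cycleCount (p * q) := by
      rw [Finset.mul_sum, Finset.sum_congr rfl fun y hy =>
        h1 p hp' q hq' y (Finset.mem_filter.mp hy).1, Finset.sum_const, nsmul_eq_mul]
    have e2 : c * ∑ z ∈ s with col z = col x, c ^ cycleCount (p * swap z x * q) =
        (s.filter fun y => col y = col x).card * c ^ cycleCount (p * q) := by
      rw [Finset.mul_sum, Finset.sum_congr rfl fun y hy =>
        h1 p hp' q hq' y (Finset.mem_filter.mp hy).1, Finset.sum_const, nsmul_eq_mul]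
    have e3 : c * ∑ y ∈ s with row y = row x, ∑ z ∈ s with col z = col x,
            c ^ cycleCount (p * swap y x * (swap z x * q)) =
        ∑ y ∈ s with row y = row x, ∑ z ∈ s with col z = col x,
          c ^ cycleCount (p * swap y z * q) := by
      simp only [Finset.mul_sum]
      refine Finset.sum_congr rfl fun y hy => Finset.sum_congr rfl fun z hz => ?_
      rw [Finset.mem_filter] at hy hz
      exact h2 p hp' q hq' y hy.1 hy.2 z hz.1 hz.2
    simp only [smul_eq_mul, ← Finset.mul_sum]
    rw [← e3]
    linear_combination ((Perm.sign q : ℤ) : ℂ) * (e1 - e2)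
  have hzero : ∑ p ∈ stab row s, ∑ q ∈ stab col s,
      ∑ y ∈ s with row y = row x, ∑ z ∈ s with col z = col x,
        ((Perm.sign q : ℤ) : ℂ) • c ^ cycleCount (p * swap y z * q) = 0 := by
    have e : ∀ (P : Finset (Sym r)) (Y Z : Finset (Fin r)) (F : Sym r → Fin r → Fin r → ℂ),
        ∑ p ∈ P, ∑ y ∈ Y, ∑ z ∈ Z, F p y z = ∑ y ∈ Y, ∑ z ∈ Z, ∑ p ∈ P, F p y z := by
      intro P Y Z F
      rw [Finset.sum_comm]
      exact Finset.sum_congr rfl fun y _ => Finset.sum_comm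
    rw [Finset.sum_congr rfl fun p _ => e _ _ _ _, e]
    refine Finset.sum_eq_zero fun y hy => Finset.sum_eq_zero fun z hz => ?_
    rw [Finset.mem_filter] at hy hz
    exact h3 y hy.1 hy.2 z hz.1 hz.2
  rw [expand, Finset.mul_sum]
  simp only [Finset.mul_sum (s := stab col s)]
  rw [Finset.sum_congr rfl fun p hp' => Finset.sum_congr rfl fun q hq' => hterm p hp' q hq']
  simp only [Finset.sum_sub_distrib]
  rw [hzero, sub_zero, cycleSum]
  simp only [Finset.mul_sum, smul_eq_mul]

end CycleSum

/-! ### The signed cycle sum as a product over boxes. -/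

section CycleSumProd

variable {r : ℕ} {row col : Fin r → ℕ}

/-- On the line through `x`, `g` is a bijection onto the indices below `g x`. It is stated for
general `f`, `g` so as to serve rows and columns alike. -/
theorem card_filter_eq {s : Finset (Fin r)} {x : Fin r} (hx : x ∉ s) {f g : Fin r → ℕ}
    (hinj : ∀ u v, f u = f v → g u = g v → u = v)
    (hmax : ∀ u ∈ s, f u + g u ≤ f x + g x)
    (hY : ∀ j < g x, ∃ w ∈ s, f w = f x ∧ g w = j) :
    (s.filter fun y => f y = f x).card = g x := by
  conv_rhs => rw [← Finset.card_range (g x)]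
  refine Finset.card_nbij g ?_ ?_ ?_
  · intro y hy
    rw [Finset.mem_coe, Finset.mem_filter] at hy
    have h1 := hmax y hy.1
    have h2 : g y ≠ g x := fun h => hx (hinj _ _ hy.2 h ▸ hy.1)
    have h3 := hy.2
    rw [Finset.mem_coe, Finset.mem_range]
    omega
  · intro y hy z hz h
    rw [Finset.mem_coe, Finset.mem_filter] at hy hz
    exact hinj _ _ (hy.2.trans hz.2.symm) h
  · intro j hj
    obtain ⟨w, hw, h1, h2⟩ := hY j (by simpa using hj)
    exact ⟨w, by simp [hw, h1], h2⟩

theorem cycleSum_eq_prod {c : ℂ} (hc : c ≠ 0)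
    (hinj : ∀ u v, row u = row v → col u = col v → u = v)
    (hY : ∀ u i j, i ≤ row u → j ≤ col u → ∃ w, row w = i ∧ col w = j) :
    cycleSum row col c Finset.univ = ∏ x, (c + ((col x : ℂ) - row x)) := by
  -- Points outside `s` are fixed and each contributes a factor `c`; the power `c ^ s.card`
  -- compensates for this. The induction runs over sets closed under moving up and left.
  have key : ∀ s : Finset (Fin r),
      (∀ u ∈ s, ∀ w, row w ≤ row u → col w ≤ col u → w ∈ s) →
      c ^ s.card * cycleSum row col c s = c ^ r * ∏ x ∈ s, (c + ((col x : ℂ) - row x)) := by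
    intro s
    -- A box maximizing `row + col` is an outer corner, so its removal leaves a set of the same
    -- kind.
    induction s using Finset.induction_on_max_value (fun u => row u + col u) with
    | empty => simp [cycleSum, stab_empty, cycleCount_eq]
    | insert x s hx hmax ih =>
      intro hl
      have hls : ∀ u ∈ s, ∀ w, row w ≤ row u → col w ≤ col u → w ∈ s := by
        intro u hu w h1 h2
        rcases Finset.mem_insert.mp (hl u (by simp [hu]) w h1 h2) with h | h
        · subst h
          have := hmax u hu
          exact hinj w u (by omega) (by omega) ▸ hu
        · exact h
      have hrow : (s.filter fun y => row y = row x).card = col x := by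
        refine card_filter_eq hx hinj hmax fun j hj => ?_
        obtain ⟨w, h1, h2⟩ := hY x (row x) j le_rfl hj.le
        rcases Finset.mem_insert.mp (hl x (by simp) w (by omega) (by omega)) with h | h
        · subst h; omega
        · exact ⟨w, h, h1, h2⟩
      have hcol : (s.filter fun y => col y = col x).card = row x := by
        refine card_filter_eq hx (fun u v h h' => hinj u v h' h)
          (fun u hu => by have := hmax u hu; omega) fun j hj => ?_
        obtain ⟨w, h1, h2⟩ := hY x j (col x) hj.le le_rfl
        rcases Finset.mem_insert.mp (hl x (by simp) w (by omega) (by omega)) with h | h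
        · subst h; omega
        · exact ⟨w, h, h2, h1⟩
      have hstep := cycleSum_insert c hx hinj (by
        intro y hy z hz hyx hzx
        have := hmax y hy
        obtain ⟨w, h1, h2⟩ := hY z (row z) (col y) le_rfl (by omega)
        exact ⟨w, hls z hz w (by omega) (by omega), h1, h2⟩)
      rw [hrow, hcol] at hstep
      rw [Finset.card_insert_of_notMem hx, Finset.prod_insert hx, pow_succ, mul_assoc, hstep]
      linear_combination (c + ((col x : ℂ) - row x)) * ih hls
  have h := key Finset.univ (fun _ _ _ _ _ => Finset.mem_univ _)
  rw [Finset.card_univ, Fintype.card_fin] at h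
  exact mul_left_cancel₀ (pow_ne_zero _ hc) h

end CycleSumProd

/-! ### Factoring a permutation through rows and columns. -/

/-- A permutation of the boxes which does not send two boxes of one column into one row is the
product of a row permutation and a column permutation. -/
theorem exists_eq_mul_of_forall_ne {r : ℕ} {row col : Fin r → ℕ} {len : ℕ → ℕ}
    (hinj : ∀ u v, row u = row v → col u = col v → u = v)
    (hlen : ∀ i j, (∃ u, row u = i ∧ col u = j) ↔ j < len i) {g : Sym r}
    (hg : ∀ u v, row u = row v → col (g⁻¹ u) = col (g⁻¹ v) → u = v) :
    ∃ p ∈ stab row Finset.univ, ∃ q ∈ stab col Finset.univ, g = p * q := by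
  have hcol : ∀ u, col u < len (row u) := fun u => (hlen _ _).mp ⟨u, rfl, rfl⟩
  choose cell hcell using fun i j => (hlen i j).mpr
  -- By counting: with `k` the length of the row of `w`, `ψ` moves `u` within its row to column `col
  -- (g⁻¹ u)` if that row has at least `k` boxes, and fixes it otherwise. It injects `A` into `B`,
  -- which has equal size, so it hits `w`.
  have key : ∀ w, ∃ u, row u = row w ∧ col (g⁻¹ u) = col w := by
    intro w
    obtain ⟨k, hk⟩ : ∃ k, k = len (row w) := ⟨_, rfl⟩
    let ψ : Fin r → Fin r := fun u =>
      if h : col (g⁻¹ u) < k ∧ k ≤ len (row u) then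
        cell (row u) (col (g⁻¹ u)) (h.1.trans_le h.2) else u
    have hψ1 : ∀ u, col (g⁻¹ u) < k → k ≤ len (row u) →
        row (ψ u) = row u ∧ col (ψ u) = col (g⁻¹ u) := by
      intro u h1 h2
      simp only [ψ, dif_pos (And.intro h1 h2)]
      exact hcell _ _ _
    have hψ2 : ∀ u, ¬ k ≤ len (row u) → ψ u = u := by
      intro u h
      simp only [ψ]
      rw [dif_neg fun h' => h h'.2]
    have hψrow : ∀ u, col (g⁻¹ u) < k → row (ψ u) = row u := by
      intro u hu
      by_cases h : k ≤ len (row u)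
      · exact (hψ1 u hu h).1
      · rw [hψ2 u h]
    let A := Finset.univ.filter fun u => col (g⁻¹ u) < k
    let B := Finset.univ.filter fun u => col u < k
    have hAB : B.card = A.card :=
      Finset.card_equiv g fun u => by simp [A, B]
    have hmaps : Set.MapsTo ψ A B := by
      intro u hu
      simp only [A, B, Finset.coe_filter, Set.mem_ofPred_eq, Finset.mem_univ, true_and] at hu ⊢
      by_cases h : k ≤ len (row u)
      · rw [(hψ1 u hu h).2]; exact hu
      · rw [hψ2 u h]
        have := hcol u
        omega
    have hinjOn : Set.InjOn ψ A := by
      intro u hu v hv h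
      simp only [A, Finset.coe_filter, Set.mem_ofPred_eq, Finset.mem_univ, true_and] at hu hv
      have hrow : row u = row v := by rw [← hψrow u hu, ← hψrow v hv, h]
      by_cases hk' : k ≤ len (row u)
      · exact hg u v hrow
          (by rw [← (hψ1 u hu hk').2, ← (hψ1 v hv (hrow ▸ hk')).2, h])
      · rwa [hψ2 u hk', hψ2 v (hrow ▸ hk')] at h
    have hsurj := Finset.surjOn_of_injOn_of_card_le ψ hmaps hinjOn hAB.le
    obtain ⟨u, hu, rfl⟩ := hsurj (show w ∈ (B : Set (Fin r)) by
      simp only [B, Finset.coe_filter, Set.mem_ofPred_eq, Finset.mem_univ, true_and]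
      rw [hk]; exact hcol w)
    simp only [A, Finset.coe_filter, Set.mem_ofPred_eq, Finset.mem_univ, true_and] at hu
    have hrow := hψrow u hu
    exact ⟨u, hrow.symm, (hψ1 u hu (by rw [hk, hrow])).2.symm⟩
  choose p hp1 hp2 using key
  have hpinj : Function.Injective p := fun w w' h =>
    hinj _ _ (by rw [← hp1 w, h, hp1]) (by rw [← hp2 w, h, hp2])
  let P : Sym r := Equiv.ofBijective p (Finite.injective_iff_bijective.mp hpinj)
  have hP : ∀ w, P w = p w := fun _ => rfl
  refine ⟨P, mem_stab.mpr fun a => ⟨by rw [hP, hp1], by simp⟩, P⁻¹ * g,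
    mem_stab.mpr fun a => ⟨?_, by simp⟩, by simp⟩
  have := hp2 ((P⁻¹ * g) a)
  rw [← this, ← hP]
  simp

/-! ### Young symmetrizers and left ideals. -/

section YoungSymmetrizer

variable {μ : YoungDiagram} {r : ℕ} (T : Tableau μ r)

/-- The row of the box numbered `a`. -/
def rowOf (a : Fin r) : ℕ := (T.symm a).1.1

/-- The column of the box numbered `a`. -/
def colOf (a : Fin r) : ℕ := (T.symm a).1.2

theorem eq_of_rowOf_eq_of_colOf_eq (u v : Fin r) (h1 : rowOf T u = rowOf T v)
    (h2 : colOf T u = colOf T v) : u = v :=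
  T.symm.injective (Subtype.ext (Prod.ext h1 h2))

theorem exists_box_iff (i j : ℕ) :
    (∃ u, rowOf T u = i ∧ colOf T u = j) ↔ j < μ.rowLen i := by
  rw [← YoungDiagram.mem_iff_lt_rowLen]
  constructor
  · rintro ⟨u, rfl, rfl⟩
    exact (T.symm u).2
  · intro h
    exact ⟨T ⟨(i, j), h⟩, by simp [rowOf], by simp [colOf]⟩

theorem exists_box_of_le (u : Fin r) (i j : ℕ) (hi : i ≤ rowOf T u) (hj : j ≤ colOf T u) :
    ∃ w, rowOf T w = i ∧ colOf T w = j := by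
  rw [exists_box_iff, ← YoungDiagram.mem_iff_lt_rowLen]
  exact μ.up_left_mem hi hj (T.symm u).2

theorem rowSymmetrizer_eq :
    rowSymmetrizer T = ∑ p ∈ stab (rowOf T) Finset.univ, MonoidAlgebra.single p 1 := by
  refine Finset.sum_congr ?_ fun _ _ => rfl
  ext σ
  simp only [Set.mem_toFinset]
  simp [rowGroup, mem_stab, rowOf]

theorem colAntisymmetrizer_eq :
    colAntisymmetrizer T = ∑ q ∈ stab (colOf T) Finset.univ,
      MonoidAlgebra.single q ((Perm.sign q : ℤ) : ℂ) := by
  refine Finset.sum_congr ?_ fun _ _ => rfl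
  ext σ
  simp only [Set.mem_toFinset]
  simp [colGroup, mem_stab, colOf]

theorem rowSymmetrizer_mul_single_mul_colAntisymmetrizer (g : Sym r) :
    rowSymmetrizer T * MonoidAlgebra.single g 1 * colAntisymmetrizer T =
      ∑ p ∈ stab (rowOf T) Finset.univ, ∑ q ∈ stab (colOf T) Finset.univ,
        ((Perm.sign q : ℤ) : ℂ) • MonoidAlgebra.single (p * g * q) (1 : ℂ) := by
  rw [rowSymmetrizer_eq, colAntisymmetrizer_eq, Finset.sum_mul, Finset.sum_mul]
  refine Finset.sum_congr rfl fun p _ => ?_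
  rw [Finset.mul_sum]
  refine Finset.sum_congr rfl fun q _ => ?_
  simp [MonoidAlgebra.single_mul_single]

theorem youngSymmetrizer_eq :
    youngSymmetrizer T = ∑ p ∈ stab (rowOf T) Finset.univ, ∑ q ∈ stab (colOf T) Finset.univ,
        ((Perm.sign q : ℤ) : ℂ) • MonoidAlgebra.single (p * q) (1 : ℂ) := by
  have := rowSymmetrizer_mul_single_mul_colAntisymmetrizer T 1
  rw [← MonoidAlgebra.one_def, mul_one] at this
  simpa [youngSymmetrizer] using this

theorem rowSymmetrizer_mul_single {p : Sym r} (hp : p ∈ stab (rowOf T) Finset.univ) :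
    rowSymmetrizer T * MonoidAlgebra.single p 1 = rowSymmetrizer T := by
  rw [rowSymmetrizer_eq, Finset.sum_mul]
  exact Finset.sum_equiv (Equiv.mulRight p) (fun σ => by simp [mul_mem_stab_iff_right hp])
    (fun σ _ => by simp [MonoidAlgebra.single_mul_single])

theorem single_mul_colAntisymmetrizer {q : Sym r} (hq : q ∈ stab (colOf T) Finset.univ) :
    MonoidAlgebra.single q 1 * colAntisymmetrizer T =
      ((Perm.sign q : ℤ) : ℂ) • colAntisymmetrizer T := by
  rw [colAntisymmetrizer_eq, Finset.mul_sum, Finset.smul_sum]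
  refine Finset.sum_equiv (Equiv.mulLeft q) (fun σ => by simp [mul_mem_stab_iff_left hq])
    (fun σ _ => ?_)
  have : ((Perm.sign q : ℤ) : ℂ) * ((Perm.sign q : ℤ) : ℂ) = 1 := by
    norm_cast
    simp
  simp [MonoidAlgebra.single_mul_single, ← mul_assoc, this]

/-- By linearity `x` is a permutation `g`. If `g = p * q`, the symmetrizers absorb `p` and `q`,
leaving `sgn q`; otherwise the obstructing pair of boxes makes the double sum cancel. -/
theorem exists_rowSymmetrizer_mul_mul_colAntisymmetrizer (x : GrpAlg r) :
    ∃ k : ℂ, rowSymmetrizer T * x * colAntisymmetrizer T = k • youngSymmetrizer T := by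
  induction x using MonoidAlgebra.induction_linear with
  | zero => exact ⟨0, by simp⟩
  | add x y hx hy =>
    obtain ⟨k, hk⟩ := hx
    obtain ⟨l, hl⟩ := hy
    exact ⟨k + l, by rw [mul_add, add_mul, hk, hl, add_smul]⟩
  | single g c =>
    suffices h : ∃ k : ℂ, rowSymmetrizer T * MonoidAlgebra.single g 1 * colAntisymmetrizer T =
        k • youngSymmetrizer T by
      obtain ⟨k, hk⟩ := h
      refine ⟨c * k, ?_⟩
      rw [mul_smul, ← hk, ← smul_mul_assoc, ← mul_smul_comm, MonoidAlgebra.smul_single, smul_eq_mul,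
        mul_one]
    by_cases hg : ∀ u v, rowOf T u = rowOf T v → colOf T (g⁻¹ u) = colOf T (g⁻¹ v) → u = v
    · obtain ⟨p, hp, q, hq, rfl⟩ := exists_eq_mul_of_forall_ne
        (eq_of_rowOf_eq_of_colOf_eq T) (exists_box_iff T) hg
      refine ⟨((Perm.sign q : ℤ) : ℂ), ?_⟩
      rw [← one_mul (1 : ℂ), ← MonoidAlgebra.single_mul_single, ← mul_assoc,
        rowSymmetrizer_mul_single T hp, mul_assoc, single_mul_colAntisymmetrizer T hq,
        mul_smul_comm, youngSymmetrizer]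
    · push Not at hg
      obtain ⟨u, v, hrow, hcol, hne⟩ := hg
      refine ⟨0, ?_⟩
      rw [rowSymmetrizer_mul_single_mul_colAntisymmetrizer, zero_smul]
      refine sum_sum_sign_smul_eq_zero (fun σ => MonoidAlgebra.single σ (1 : ℂ))
        (swap_mem_stab (Finset.mem_univ u) (Finset.mem_univ v) hrow)
        (swap_mem_stab (Finset.mem_univ (g⁻¹ u)) (Finset.mem_univ (g⁻¹ v)) hcol)
        (fun h => hne (g⁻¹.injective h)) ?_
      rw [Equiv.mul_swap_eq_swap_mul]
      simp

theorem exists_youngSymmetrizer_mul_mul (x : GrpAlg r) :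
    ∃ k : ℂ, youngSymmetrizer T * x * youngSymmetrizer T = k • youngSymmetrizer T := by
  obtain ⟨k, hk⟩ := exists_rowSymmetrizer_mul_mul_colAntisymmetrizer T
    (colAntisymmetrizer T * x * rowSymmetrizer T)
  exact ⟨k, by rw [← hk]; simp only [youngSymmetrizer, mul_assoc]⟩

/-- Maschke's theorem gives a left-linear projection onto `N`; it is right multiplication by its
value at 1. -/
theorem exists_mul_right_eq (N : Submodule (GrpAlg r) (GrpAlg r)) :
    ∃ f ∈ N, ∀ x ∈ N, x * f = x := by
  obtain ⟨π, hπ⟩ := MonoidAlgebra.exists_leftInverse_of_injective N.subtype N.ker_subtype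
  refine ⟨π 1, (π 1).2, fun x hx => ?_⟩
  have h := LinearMap.congr_fun hπ ⟨x, hx⟩
  have h2 : π x = x • π 1 := by rw [← map_smul, smul_eq_mul, mul_one]
  have h3 : π x = ⟨x, hx⟩ := h
  rw [h3] at h2
  exact (congrArg Subtype.val h2).symm

/-- If `e` annihilates `N`, then `x = x f` with `x` in the ideal of `e` and `f` in `N` forces `x =
0`. Otherwise some `e w e = k e` with `k ≠ 0` lies in `N`. -/
theorem eq_bot_or_youngSymmetrizer_mem {N : Submodule (GrpAlg r) (GrpAlg r)}
    (hN : N ≤ spechtModule T) : N = ⊥ ∨ youngSymmetrizer T ∈ N := by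
  by_cases h : ∀ y ∈ N, youngSymmetrizer T * y = 0
  · left
    rw [eq_bot_iff]
    intro x hx
    obtain ⟨f, hf, hfN⟩ := exists_mul_right_eq N
    obtain ⟨w, rfl⟩ := Submodule.mem_span_singleton.mp (hN hx)
    rw [Submodule.mem_bot, ← hfN _ hx, smul_eq_mul, mul_assoc, h f hf, mul_zero]
  · right
    push Not at h
    obtain ⟨y, hy, hne⟩ := h
    obtain ⟨w, rfl⟩ := Submodule.mem_span_singleton.mp (hN hy)
    obtain ⟨k, hk⟩ := exists_youngSymmetrizer_mul_mul T w
    rw [smul_eq_mul, ← mul_assoc, hk] at hne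
    have hk0 : k ≠ 0 := fun h => hne (by rw [h, zero_smul])
    have := N.smul_mem (MonoidAlgebra.single 1 k⁻¹ * youngSymmetrizer T) hy
    rw [smul_eq_mul, smul_eq_mul, mul_assoc, ← mul_assoc (youngSymmetrizer T), hk] at this
    have e : MonoidAlgebra.single 1 k⁻¹ * (k • youngSymmetrizer T) = youngSymmetrizer T := by
      rw [show (MonoidAlgebra.single 1 k⁻¹ : GrpAlg r) = k⁻¹ • 1 by
        rw [MonoidAlgebra.one_def, MonoidAlgebra.smul_single, smul_eq_mul, mul_one],
        smul_mul_assoc, one_mul, smul_smul, inv_mul_cancel₀ hk0, one_smul]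
    rwa [e] at this

/-- With right identity `f = w e`, one has `z e = z e w e = e (z w) e`, a multiple of `e`. -/
theorem exists_central_mul_youngSymmetrizer {z : GrpAlg r}
    (hz : z ∈ Subalgebra.center ℂ (GrpAlg r)) :
    ∃ k : ℂ, z * youngSymmetrizer T = k • youngSymmetrizer T := by
  obtain ⟨f, hf, hfN⟩ := exists_mul_right_eq (spechtModule T)
  obtain ⟨w, rfl⟩ := Submodule.mem_span_singleton.mp hf
  obtain ⟨k, hk⟩ := exists_youngSymmetrizer_mul_mul T (z * w)
  refine ⟨k, ?_⟩
  rw [Subalgebra.mem_center_iff] at hz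
  have h := hfN _ (Submodule.mem_span_singleton_self _)
  rw [smul_eq_mul, ← mul_assoc] at h
  rw [← hk, ← mul_assoc, hz, mul_assoc, mul_assoc, ← mul_assoc _ w, h]

end YoungSymmetrizer

/-! ### The central cycle element. -/

section CycleElement

variable {r : ℕ}

theorem sum_conjClasses {M : Type*} [AddCommMonoid M] (F : ConjClasses (Sym r) → Sym r → M) :
    ∑ α : ConjClasses (Sym r), ∑ σ ∈ α.carrier.toFinset, F α σ =
      ∑ σ : Sym r, F (ConjClasses.mk σ) σ := by
  rw [← Finset.sum_fiberwise Finset.univ fun σ : Sym r => ConjClasses.mk σ]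
  refine Finset.sum_congr rfl fun α _ => Finset.sum_congr ?_ ?_
  · ext σ
    simp [ConjClasses.mem_carrier_iff_mk_eq]
  · intro σ hσ
    rw [(Finset.mem_filter.mp hσ).2]

theorem cycleElement_eq (c : ℂ) :
    cycleElement r c = ∑ σ : Sym r, MonoidAlgebra.single σ (c ^ cycleCount σ) := by
  simp only [cycleElement, classSum, Finset.smul_sum, MonoidAlgebra.smul_single, smul_eq_mul,
    mul_one]
  exact sum_conjClasses fun α σ => MonoidAlgebra.single σ (c ^ classCycleCount α)

theorem cycleElement_mem_center (c : ℂ) :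
    cycleElement r c ∈ Subalgebra.center ℂ (GrpAlg r) := by
  rw [Subalgebra.mem_center_iff]
  intro x
  induction x using MonoidAlgebra.induction_linear with
  | zero => simp
  | add x y hx hy => rw [add_mul, mul_add, hx, hy]
  | single g k =>
    rw [cycleElement_eq, Finset.mul_sum, Finset.sum_mul]
    refine Finset.sum_equiv (MulAut.conj g).toEquiv (by simp) fun σ _ => ?_
    simp [MonoidAlgebra.single_mul_single, cycleCount_conj, mul_comm]

theorem coeff_cycleElement (c : ℂ) (σ : Sym r) :
    (cycleElement r c).coeff σ = c ^ cycleCount σ := by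
  rw [cycleElement_eq, MonoidAlgebra.coeff_sum, Finset.sum_apply']
  simp [Finsupp.single_apply]

end CycleElement

/-! ### Irreducibility, eigenvalue and trace. -/

section FrameRep

variable {μ : YoungDiagram} {r : ℕ} (T : Tableau μ r)

/-- Only `p = q = 1` contributes, since a permutation preserving both rows and columns is trivial.
This normalization lets scalars be read off at the identity. -/
theorem coeff_youngSymmetrizer_one : (youngSymmetrizer T).coeff 1 = 1 := by
  have h1 : ∀ {f : Fin r → ℕ}, (1 : Sym r) ∈ stab f Finset.univ := by simp [mem_stab]
  have key : ∀ p ∈ stab (rowOf T) Finset.univ, ∀ q ∈ stab (colOf T) Finset.univ,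
      p * q = 1 → q = 1 := by
    intro p hp q hq h
    rw [eq_inv_of_mul_eq_one_right h] at hq ⊢
    ext a
    congr 1
    exact eq_of_rowOf_eq_of_colOf_eq T _ _ (mem_stab.mp (inv_mem_stab hp) a).1 (mem_stab.mp hq a).1
  rw [youngSymmetrizer_eq, ← Finset.sum_product', MonoidAlgebra.coeff_sum, Finset.sum_apply',
    Finset.sum_eq_single (1, 1)]
  · simp
  · rintro ⟨p, q⟩ hpq hne
    rw [Finset.mem_product] at hpq
    have : p * q ≠ 1 := by
      intro h
      have hq := key p hpq.1 q hpq.2 h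
      rw [hq, mul_one] at h
      exact hne (by rw [hq, h])
    simp [this]
  · intro h
    exact absurd (Finset.mem_product.mpr ⟨h1, h1⟩) h

theorem youngSymmetrizer_ne_zero : youngSymmetrizer T ≠ 0 := by
  intro h
  have := coeff_youngSymmetrizer_one T
  simp [h] at this

theorem coeff_cycleElement_mul_youngSymmetrizer (c : ℂ) :
    (cycleElement r c * youngSymmetrizer T).coeff 1 =
      cycleSum (rowOf T) (colOf T) c Finset.univ := by
  rw [youngSymmetrizer_eq, cycleSum, Finset.mul_sum, MonoidAlgebra.coeff_sum, Finset.sum_apply']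
  refine Finset.sum_congr rfl fun p _ => ?_
  rw [Finset.mul_sum, MonoidAlgebra.coeff_sum, Finset.sum_apply']
  refine Finset.sum_congr rfl fun q _ => ?_
  rw [mul_smul_comm, MonoidAlgebra.coeff_smul_apply, MonoidAlgebra.coeff_mul_single_apply, mul_one,
    one_mul, coeff_cycleElement, cycleCount_inv]

theorem frameRep_apply (g : Sym r) (v : spechtModule T) :
    frameRep T g v = (MonoidAlgebra.single g 1 : GrpAlg r) • v := rfl

theorem frameRep_asAlgebraHom_apply (x : GrpAlg r) (v : spechtModule T) :
    (frameRep T).asAlgebraHom x v = x • v := by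
  induction x using MonoidAlgebra.induction_linear with
  | zero => simp
  | add x y hx hy => rw [map_add, LinearMap.add_apply, hx, hy, add_smul]
  | single g k =>
    rw [Representation.asAlgebraHom_single, LinearMap.smul_apply, frameRep_apply, ← smul_assoc,
      MonoidAlgebra.smul_single, smul_eq_mul, mul_one]

instance : Nontrivial (spechtModule T) :=
  ⟨⟨⟨_, Submodule.mem_span_singleton_self _⟩, 0, fun h =>
    youngSymmetrizer_ne_zero T (congrArg Subtype.val h)⟩⟩

theorem frameRep_isIrreducible : (frameRep T).IsIrreducible := by
  have smul_mem : ∀ (N : Subrepresentation (frameRep T)) (x : GrpAlg r) (v : spechtModule T),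
      v ∈ N.toSubmodule → x • v ∈ N.toSubmodule := by
    intro N x v hv
    rw [← frameRep_asAlgebraHom_apply]
    induction x using MonoidAlgebra.induction_linear with
    | zero => simp
    | add x y hx hy => rw [map_add]; exact N.toSubmodule.add_mem hx hy
    | single g k =>
      rw [Representation.asAlgebraHom_single]
      exact N.toSubmodule.smul_mem _ (N.apply_mem_toSubmodule g hv)
  refine { exists_pair_ne := ⟨⊥, ⊤, fun h => ?_⟩, eq_bot_or_eq_top := fun N => ?_ }
  · have h' : (⊥ : Submodule ℂ (spechtModule T)) = ⊤ := congrArg Subrepresentation.toSubmodule h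
    exact bot_ne_top h'
  -- A subrepresentation is stable under the whole group algebra, so its image is a left ideal to
  -- which the dichotomy applies.
  · let N' : Submodule (GrpAlg r) (spechtModule T) :=
      { N.toSubmodule.toAddSubmonoid with smul_mem' := fun x v hv => smul_mem N x v hv }
    have hN' : ∀ v, v ∈ N' ↔ v ∈ N.toSubmodule := fun _ => Iff.rfl
    have hle : N'.map (spechtModule T).subtype ≤ spechtModule T := by
      rintro _ ⟨v, _, rfl⟩
      exact v.2
    rcases eq_bot_or_youngSymmetrizer_mem T hle with h | h
    · left
      refine Subrepresentation.toSubmodule_injective ((Submodule.eq_bot_iff _).mpr fun v hv => ?_)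
      have : (v : GrpAlg r) ∈ N'.map (spechtModule T).subtype := ⟨v, hv, rfl⟩
      rw [h, Submodule.mem_bot] at this
      exact Subtype.ext this
    · right
      refine Subrepresentation.toSubmodule_injective (Submodule.eq_top_iff'.mpr fun v => ?_)
      obtain ⟨u, hu, hue⟩ := h
      obtain ⟨w, hw⟩ := Submodule.mem_span_singleton.mp v.2
      have : w • u = v := Subtype.ext (by rw [← hw, ← hue]; rfl)
      rw [← this]
      exact smul_mem N w u hu

theorem tPoly_eval {V : Type*} [AddCommGroup V] [Module ℂ V] (ρ : Representation ℂ (Sym r) V)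
    (c : ℂ) : (tPoly ρ).eval c = (Module.finrank ℂ V : ℂ)⁻¹ *
      LinearMap.trace ℂ V (ρ.asAlgebraHom (cycleElement r c)) := by
  have h : ∀ α : ConjClasses (Sym r), (classSize α : ℂ) * classChar ρ α * c ^ classCycleCount α =
      ∑ σ ∈ α.carrier.toFinset, classChar ρ α * c ^ classCycleCount α := by
    intro α
    rw [Finset.sum_const, nsmul_eq_mul, classSize, Set.ncard_eq_toFinset_card', mul_assoc]
  rw [tPoly, eval_mul, eval_C, eval_finsetSum]
  simp only [eval_mul, eval_C, eval_pow, eval_X]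
  rw [Finset.sum_congr rfl fun α _ => h α,
    sum_conjClasses fun α _ => classChar ρ α * c ^ classCycleCount α, cycleElement_eq, map_sum,
    map_sum]
  congr 1
  refine Finset.sum_congr rfl fun σ _ => ?_
  rw [Representation.asAlgebraHom_single, map_smul, smul_eq_mul, mul_comm]
  rfl

/-- The scalar on `e` is found by comparing coefficients at the identity; centrality carries it to
every `w e`. -/
theorem cycleElement_smul (c : ℂ) (v : spechtModule T) :
    cycleElement r c • v = (cycleSum (rowOf T) (colOf T) c Finset.univ) • v := by
  have hz := cycleElement_mem_center (r := r) c
  obtain ⟨k, hk⟩ := exists_central_mul_youngSymmetrizer T hz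
  have hk' := coeff_cycleElement_mul_youngSymmetrizer T c
  rw [hk, MonoidAlgebra.coeff_smul_apply, coeff_youngSymmetrizer_one, smul_eq_mul, mul_one] at hk'
  obtain ⟨w, hw⟩ := Submodule.mem_span_singleton.mp v.2
  refine Subtype.ext ?_
  rw [Submodule.coe_smul, Submodule.coe_smul_of_tower, ← hw, smul_eq_mul, smul_eq_mul, ← hk',
    ← mul_assoc, ← Subalgebra.mem_center_iff.mp hz w, mul_assoc, hk, mul_smul_comm]

theorem tPoly_frameRep_eval (c : ℂ) :
    (tPoly (frameRep T)).eval c = cycleSum (rowOf T) (colOf T) c Finset.univ := by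
  have h : (frameRep T).asAlgebraHom (cycleElement r c) =
      cycleSum (rowOf T) (colOf T) c Finset.univ • LinearMap.id := by
    ext1 v
    rw [frameRep_asAlgebraHom_apply, cycleElement_smul, LinearMap.smul_apply, LinearMap.id_apply]
  have : FiniteDimensional ℂ (GrpAlg r) := by
    unfold GrpAlg; infer_instance
  have : FiniteDimensional ℂ (spechtModule T) :=
    FiniteDimensional.of_injective ((spechtModule T).subtype.restrictScalars ℂ)
      Subtype.val_injective
  have hn : (Module.finrank ℂ (spechtModule T) : ℂ) ≠ 0 :=
    Nat.cast_ne_zero.mpr Module.finrank_pos.ne'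
  rw [tPoly_eval, h, map_smul, LinearMap.trace_id, smul_eq_mul]
  field_simp

theorem tPoly_frameRep_eq_prod_cells :
    tPoly (frameRep T) = ∏ x ∈ μ.cells, (X + C ((x.2 : ℂ) - (x.1 : ℂ))) := by
  -- The cycle sum was evaluated only for `c ≠ 0`, which still gives infinitely many points.
  refine Polynomial.eq_of_infinite_eval_eq _ _ (Set.Infinite.mono (s := {0}ᶜ) ?_
    (Set.finite_singleton 0).infinite_compl)
  intro c hc
  show eval c _ = eval c _
  rw [tPoly_frameRep_eval, cycleSum_eq_prod hc (eq_of_rowOf_eq_of_colOf_eq T)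
    (exists_box_of_le T), eval_prod, ← Finset.prod_coe_sort μ.cells,
    ← T.prod_comp]
  simp [rowOf, colOf]

end FrameRep

/-! ### From boxes to rising factorials. -/

theorem ascPochhammer_comp_eq_prod (n i : ℕ) :
    (ascPochhammer ℂ n).comp (X - C (i : ℂ)) =
      ∏ j ∈ Finset.range n, (X + C ((j : ℂ) - (i : ℂ))) := by
  induction n with
  | zero => simp
  | succ n ih =>
    rw [ascPochhammer_succ_right, mul_comp, ih, Finset.prod_range_succ]
    simp only [add_comp, X_comp, natCast_comp, map_sub, map_natCast]
    ring

/-- Rows past the last nonempty one have length zero and contribute empty products, so any `p`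
bounding the number of rows will do. -/
theorem prod_cells_eq {M : Type*} [CommMonoid M] {μ : YoungDiagram} {p : ℕ}
    (hp : μ.colLen 0 ≤ p) (f : ℕ → ℕ → M) :
    ∏ x ∈ μ.cells, f x.1 x.2 = ∏ i ∈ Finset.range p, ∏ j ∈ Finset.range (μ.rowLen i), f i j := by
  refine Finset.prod_finset_product _ _ (fun i => Finset.range (μ.rowLen i)) fun x => ?_
  rw [Finset.mem_range, Finset.mem_range, YoungDiagram.mem_cells, ← YoungDiagram.mem_iff_lt_rowLen,
    iff_and_self]
  intro h
  exact ((YoungDiagram.mem_iff_lt_colLen.mp h).trans_le (μ.colLen_anti _ _ (Nat.zero_le _))).trans_le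
    hp

end FrameRep

end

theorem mainTheorem6 (r p : ℕ) (μ : YoungDiagram) (hp : μ.colLen 0 ≤ p)
    (T : FrameRep.Tableau μ r) :
    -- the representation labelled by the frame is irreducible
    (FrameRep.frameRep T).IsIrreducible ∧
    -- the product formula; `ascPochhammer ℂ k` is the rising factorial of length `k`
    FrameRep.tPoly (FrameRep.frameRep T) =
      ∏ i ∈ Finset.range p,
        (ascPochhammer ℂ (μ.rowLen i)).comp (Polynomial.X - Polynomial.C (i : ℂ)) ∧
    -- the same polynomial as a product over the boxes
    FrameRep.tPoly (FrameRep.frameRep T) =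
      ∏ x ∈ μ.cells, (Polynomial.X + Polynomial.C ((x.2 : ℂ) - (x.1 : ℂ))) ∧
    -- the central element and its eigenvalue
    ∀ c : ℂ,
      FrameRep.cycleElement r c =
        ∑ σ : FrameRep.Sym r, MonoidAlgebra.single σ (c ^ FrameRep.cycleCount σ) ∧
      FrameRep.cycleElement r c ∈ Subalgebra.center ℂ (FrameRep.GrpAlg r) ∧
      ∀ v : FrameRep.spechtModule T,
        (FrameRep.frameRep T).asAlgebraHom (FrameRep.cycleElement r c) v =
          (FrameRep.tPoly (FrameRep.frameRep T)).eval c • v := by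
  refine ⟨FrameRep.frameRep_isIrreducible T, ?_, FrameRep.tPoly_frameRep_eq_prod_cells T,
    fun c => ⟨FrameRep.cycleElement_eq c, FrameRep.cycleElement_mem_center c, fun v => ?_⟩⟩
  · rw [FrameRep.tPoly_frameRep_eq_prod_cells T, FrameRep.prod_cells_eq hp
      fun i j => Polynomial.X + Polynomial.C ((j : ℂ) - (i : ℂ))]
    exact Finset.prod_congr rfl fun i _ => (FrameRep.ascPochhammer_comp_eq_prod _ i).symm
  · rw [FrameRep.frameRep_asAlgebraHom_apply, FrameRep.cycleElement_smul,
      FrameRep.tPoly_frameRep_eval]
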